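/- Let $\mathbb F=\mathbb R$ or $\mathbb C$, let $\mathrm{Sym}_n=\mathrm{Sym}_n(\mathbb F)$ be the real vector space of $n\times n$ real symmetric (respectively complex Hermitian) matrices, and let $\widehat\lambda_1(A)\le\dots\le\widehat\lambda_n(A)$ be the eigenvalues of $A\in\mathrm{Sym}_n$, repeated according to multiplicity. Let $M$ be a smooth ($C^\infty$) $d$-dimensional manifold, $\mathcal F:M\to\mathrm{Sym}_n$ a smooth map, $1\le k\le n$, and $\lambda_k:=\widehat\lambda_k\circ\mathcal F$. The multiplicity of $\lambda_k$ at a point $y\in M$ is the dimension of the eigenspace of $\mathcal F(y)$ for the eigenvalue $\lambda_k(y)$. Let $x\in M$ be a point where $\lambda_k$ has multiplicity $\nu\ge 1$, and let $U:\mathbb F^\nu\to\mathbb F^n$ be a linear isometry onto the eigenspace of $\mathcal F(x)$ for the eigenvalue $\lambda_k(x)$. Define the linear operator $$\mathcal H_x:T_xM\to\mathrm{Sym}_\nu,\qquad \mathcal H_x v=U^*\big(d\mathcal F(x)v\big)U .$$ Assume that the non-degenerate criticality condition (N) holds at $x$: the orthogonal complement of $\operatorname{Ran}\mathcal H_x$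 in $\mathrm{Sym}_\nu$, with respect to the Frobenius inner product $\langle X,Y\rangle=\operatorname{Tr}(XY)$, is the real line spanned by a positive definite matrix $B\in\mathrm{Sym}_\nu$ (this does not depend on the choice of $U$). Then there is a smooth embedded submanifold $S\subset M$ such that for all $y$ in some neighborhood of $x$ in $M$, the multiplicity of $\lambda_k$ at $y$ equals $\nu$ if and only if $y\in S$ (in particular $x\in S$), and such that: 1. $S$ has codimension $s(\nu):=\dim_{\mathbb R}\mathrm{Sym}_\nu(\mathbb F)-1$ in $M$; 2. the restriction $\lambda_k|_S$ is a smooth function on $S$ with a critical point at $x$, i.e. $d(\lambda_k|_S)(x)=0$. -/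

import Mathlib

open scoped Manifold ContDiff Matrix Topology ComplexOrder

noncomputable section

namespace EigStratum

/-- The real vector space of `n × n` self-adjoint matrices over `𝕜` (real symmetric for `𝕜 = ℝ`,
complex Hermitian for `𝕜 = ℂ`), normed below by the Frobenius norm. -/
def Sym (𝕜 : Type*) [RCLike 𝕜] (n : ℕ) : Type _ :=
  ↥(selfAdjoint.submodule ℝ (Matrix (Fin n) (Fin n) 𝕜))

variable {𝕜 : Type*} [RCLike 𝕜] {n : ℕ}

open scoped Matrix.Norms.Frobenius in
instance : NormedAddCommGroup (Sym 𝕜 n) :=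
  inferInstanceAs (NormedAddCommGroup ↥(selfAdjoint.submodule ℝ (Matrix (Fin n) (Fin n) 𝕜)))

open scoped Matrix.Norms.Frobenius in
instance : NormedSpace ℝ (Sym 𝕜 n) :=
  inferInstanceAs (NormedSpace ℝ ↥(selfAdjoint.submodule ℝ (Matrix (Fin n) (Fin n) 𝕜)))

/-- The inclusion of the self-adjoint matrices into all matrices. -/
def Sym.toMatrix : Sym 𝕜 n →ₗ[ℝ] Matrix (Fin n) (Fin n) 𝕜 :=
  (selfAdjoint.submodule ℝ (Matrix (Fin n) (Fin n) 𝕜)).subtype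

theorem Sym.isHermitian (A : Sym 𝕜 n) : (Sym.toMatrix A).IsHermitian :=
  A.2

/-- The `k`-th eigenvalue of `A`, in increasing order with multiplicity; indices start at `0`.
(Mathlib's `eigenvalues₀` is in decreasing order.) -/
def eigval (k : Fin n) (A : Sym 𝕜 n) : ℝ :=
  A.isHermitian.eigenvalues₀ (Fin.cast (Fintype.card_fin n).symm k.rev)

/-- The eigenspace of `A` belonging to its `k`-th eigenvalue. -/
def eigspace (k : Fin n) (A : Sym 𝕜 n) : Submodule 𝕜 (Fin n → 𝕜) :=
  Module.End.eigenspace (Matrix.toLin' A.toMatrix) ((eigval k A : ℝ) : 𝕜)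

/-- The multiplicity of the `k`-th eigenvalue of `A`. -/
def eigmult (k : Fin n) (A : Sym 𝕜 n) : ℕ :=
  Module.finrank 𝕜 (eigspace k A)

/-- The columns of `U` form an orthonormal basis of `E`; that is, `U` is a linear isometry
`𝕜^ν → 𝕜^n` with range `E`. -/
def IsIsometryOnto {ν : ℕ} (U : Matrix (Fin n) (Fin ν) 𝕜) (E : Submodule 𝕜 (Fin n → 𝕜)) : Prop :=
  Uᴴ * U = 1 ∧ LinearMap.range U.mulVecLin = E

/-- The compression `X ↦ U* X U`. -/
def compression {ν : ℕ} (U : Matrix (Fin n) (Fin ν) 𝕜) : Sym 𝕜 n →ₗ[ℝ] Sym 𝕜 ν where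
  toFun X := ⟨Uᴴ * X.toMatrix * U, Matrix.isHermitian_conjTranspose_mul_mul U X.isHermitian⟩
  map_add' X Y := by
    apply Subtype.ext
    change Uᴴ * (X + Y).toMatrix * U = Uᴴ * X.toMatrix * U + Uᴴ * Y.toMatrix * U
    rw [map_add, Matrix.mul_add, Matrix.add_mul]
  map_smul' c X := by
    apply Subtype.ext
    change Uᴴ * (c • X).toMatrix * U = c • (Uᴴ * X.toMatrix * U)
    rw [map_smul, Matrix.mul_smul, Matrix.smul_mul]

/-- The orthogonal complement in `Sym 𝕜 ν` for the Frobenius inner product `⟨X, Y⟩ = Tr (X Y)`. -/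
def frobeniusPerp {ν : ℕ} (V : Submodule ℝ (Sym 𝕜 ν)) : Submodule ℝ (Sym 𝕜 ν) where
  carrier := {Y | ∀ X ∈ V, Matrix.trace (X.toMatrix * Y.toMatrix) = 0}
  add_mem' {Y Z} hY hZ X hX := by
    rw [map_add, Matrix.mul_add, Matrix.trace_add, hY X hX, hZ X hX, add_zero]
  zero_mem' X _ := by rw [map_zero, Matrix.mul_zero, Matrix.trace_zero]
  smul_mem' c Y hY X hX := by
    rw [map_smul, Matrix.mul_smul, Matrix.trace_smul, hY X hX, smul_zero]

/-- `s(ν) = dim Sym_ν(𝕜) - 1`, the dimension being the real one (it is positive for `ν ≥ 1`). -/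
def stratumCodim (𝕜 : Type*) [RCLike 𝕜] (ν : ℕ) : ℕ :=
  Module.finrank ℝ (Sym 𝕜 ν) - 1

variable {d : ℕ} {M : Type*} [TopologicalSpace M] [ChartedSpace (EuclideanSpace ℝ (Fin d)) M]

/-- The operator `v ↦ U* (dF(x) v) U` from `T_x M` to `Sym_ν`. -/
def compressedDeriv {ν : ℕ} (F : M → Sym 𝕜 n) (x : M) (U : Matrix (Fin n) (Fin ν) 𝕜) :
    TangentSpace (𝓡 d) x →ₗ[ℝ] Sym 𝕜 ν :=
  compression U ∘ₗ (mfderiv (𝓡 d) 𝓘(ℝ, Sym 𝕜 n) F x).toLinearMap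

/-- The non-degenerate criticality condition (N) at `x` for the `k`-th eigenvalue of `F`, which has
multiplicity `ν` at `x`: the orthogonal complement of the range of `v ↦ U* (dF(x) v) U` is spanned
by a positive definite matrix, where `U` is an isometry onto the eigenspace at `x`. (Another choice
of `U` changes everything by a unitary conjugation, so the choice does not matter.) -/
def ConditionN (F : M → Sym 𝕜 n) (k : Fin n) (ν : ℕ) (x : M) : Prop :=
  ∃ U : Matrix (Fin n) (Fin ν) 𝕜, IsIsometryOnto U (eigspace k (F x)) ∧
    ∃ B : Sym 𝕜 ν, B.toMatrix.PosDef ∧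
      frobeniusPerp (LinearMap.range (compressedDeriv (d := d) F x U)) = Submodule.span ℝ {B}

end EigStratum

end

/-!
Let `U` be an isometry onto the eigenspace of `A₀ = F x`. The Grushin matrix `[[A - t, U], [U*, 0]]`
is invertible for `(A, t)` near `(A₀, λ_k(A₀))`, and the lower right block `E(A, t)` of its inverse,
a self-adjoint `ν × ν` matrix, has a kernel of the same dimension as that of `A - t`. Hence `t` is
an eigenvalue of `A` of multiplicity `ν` exactly when `E(A, t) = 0`.

To first order `E(A₀ + X, λ_k(A₀) + t) ≈ t - U* X U`. So the scalar equation `Tr E(A, t) = 0` can be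
solved for `t = μ(A)`, and what remains of `E = 0` is the vanishing of `E(A, μ(A))` modulo scalar
matrices. The derivative of this equation along `F` is `v ↦ U* (dF(x) v) U` modulo scalars, which is
surjective as soon as the range of `v ↦ U* (dF(x) v) U` and the scalar matrices together span
`Sym_ν`: the stratum is then a regular level set, of codimension `dim Sym_ν - 1`, on which
`λ_k = μ ∘ F`. A tangent vector `v` of the stratum satisfies `U* (dF(x) v) U = c` for a scalar `c`,
and then `c` is the derivative of `λ_k` along `v`.

Under condition (N) the range of `v ↦ U* (dF(x) v) U` is the hyperplane orthogonal to `B`; since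
`Tr B > 0`, it is complementary to the scalar matrices, so that `c = 0`.
-/

noncomputable section

namespace EigStratum

section Weyl

variable {𝕜 E : Type*}

theorem exists_ne_zero_repr_eq_zero {ι : Type*} [Finite ι] [LinearOrder ι] [Field 𝕜]
    [AddCommGroup E] [Module 𝕜 E] (b c : Module.Basis ι 𝕜 E) (i : ι) :
    ∃ v ≠ 0, (∀ j > i, b.repr v j = 0) ∧ ∀ j < i, c.repr v j = 0 := by
  cases nonempty_fintype ι
  let f : E →ₗ[𝕜] ι → 𝕜 := LinearMap.pi fun j =>
    if i < j then b.coord j else if j < i then c.coord j else 0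
  have hf_surj : ¬Function.Surjective f := fun h => by
    obtain ⟨v, hv⟩ := h (Pi.single i 1)
    simpa [f] using congrFun hv i
  have : FiniteDimensional 𝕜 E := b.finiteDimensional_of_finite
  have hf_inj : ¬Function.Injective f := by
    rwa [LinearMap.injective_iff_surjective_of_finrank_eq_finrank]
    rw [Module.finrank_eq_card_basis b, Module.finrank_fintype_fun_eq_card]
  obtain ⟨v, hv, hv0⟩ := Submodule.exists_mem_ne_zero_of_ne_bot (mt LinearMap.ker_eq_bot.1 hf_inj)
  refine ⟨v, hv0, fun j hj => ?_, fun j hj => ?_⟩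
  · simpa [f, hj] using congrFun (LinearMap.mem_ker.1 hv) j
  · simpa [f, hj, hj.not_gt] using congrFun (LinearMap.mem_ker.1 hv) j

variable [RCLike 𝕜] [NormedAddCommGroup E] [InnerProductSpace 𝕜 E] [FiniteDimensional 𝕜 E] {n : ℕ}
  {S T : E →ₗ[𝕜] E}

theorem re_inner_apply_self_eq_sum_eigenvalues (hT : T.IsSymmetric)
    (hn : Module.finrank 𝕜 E = n) (v : E) :
    RCLike.re (inner 𝕜 v (T v)) =
      ∑ j, hT.eigenvalues hn j * ‖(hT.eigenvectorBasis hn).repr v j‖ ^ 2 := by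
  rw [← (hT.eigenvectorBasis hn).repr.inner_map_map, PiLp.inner_apply, map_sum]
  refine Finset.sum_congr rfl fun j _ => ?_
  rw [hT.eigenvectorBasis_apply_self_apply hn, ← smul_eq_mul, inner_smul_right,
    inner_self_eq_norm_sq_to_K, ← RCLike.ofReal_pow, ← RCLike.ofReal_mul, RCLike.ofReal_re]

theorem eigenvalues_mul_norm_sq_le_re_inner (hT : T.IsSymmetric) (hn : Module.finrank 𝕜 E = n)
    {i : Fin n} {v : E} (hv : ∀ j > i, (hT.eigenvectorBasis hn).repr v j = 0) :
    hT.eigenvalues hn i * ‖v‖ ^ 2 ≤ RCLike.re (inner 𝕜 v (T v)) := by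
  rw [re_inner_apply_self_eq_sum_eigenvalues hT hn, ← (hT.eigenvectorBasis hn).repr.norm_map,
    EuclideanSpace.norm_sq_eq, Finset.mul_sum]
  refine Finset.sum_le_sum fun j _ => ?_
  rcases lt_or_ge i j with hj | hj
  · simp [hv j hj]
  · gcongr
    exact hT.eigenvalues_antitone hn hj

theorem re_inner_le_eigenvalues_mul_norm_sq (hT : T.IsSymmetric) (hn : Module.finrank 𝕜 E = n)
    {i : Fin n} {v : E} (hv : ∀ j < i, (hT.eigenvectorBasis hn).repr v j = 0) :
    RCLike.re (inner 𝕜 v (T v)) ≤ hT.eigenvalues hn i * ‖v‖ ^ 2 := by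
  rw [re_inner_apply_self_eq_sum_eigenvalues hT hn, ← (hT.eigenvectorBasis hn).repr.norm_map,
    EuclideanSpace.norm_sq_eq, Finset.mul_sum]
  refine Finset.sum_le_sum fun j _ => ?_
  rcases lt_or_ge j i with hj | hj
  · simp [hv j hj]
  · gcongr
    exact hT.eigenvalues_antitone hn hj

theorem eigenvalues_le_eigenvalues_add (hS : S.IsSymmetric) (hT : T.IsSymmetric)
    (hn : Module.finrank 𝕜 E = n) {C : ℝ}
    (h : ∀ v, RCLike.re (inner 𝕜 v (S v)) ≤ RCLike.re (inner 𝕜 v (T v)) + C * ‖v‖ ^ 2)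
    (i : Fin n) : hS.eigenvalues hn i ≤ hT.eigenvalues hn i + C := by
  obtain ⟨v, hv0, hSv, hTv⟩ := exists_ne_zero_repr_eq_zero
    (hS.eigenvectorBasis hn).toBasis (hT.eigenvectorBasis hn).toBasis i
  have hv : 0 < ‖v‖ ^ 2 := by positivity
  refine le_of_mul_le_mul_right ?_ hv
  calc
    hS.eigenvalues hn i * ‖v‖ ^ 2 ≤ RCLike.re (inner 𝕜 v (S v)) :=
      eigenvalues_mul_norm_sq_le_re_inner hS hn hSv
    _ ≤ RCLike.re (inner 𝕜 v (T v)) + C * ‖v‖ ^ 2 := h v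
    _ ≤ hT.eigenvalues hn i * ‖v‖ ^ 2 + C * ‖v‖ ^ 2 := by
      gcongr
      exact re_inner_le_eigenvalues_mul_norm_sq hT hn hTv
    _ = (hT.eigenvalues hn i + C) * ‖v‖ ^ 2 := by ring

end Weyl

section Eigenvalues

variable {𝕜 : Type*} [RCLike 𝕜] {n : ℕ}

instance : FiniteDimensional ℝ (Sym 𝕜 n) :=
  inferInstanceAs (FiniteDimensional ℝ ↥(selfAdjoint.submodule ℝ (Matrix (Fin n) (Fin n) 𝕜)))

theorem Sym.toMatrix_injective : Function.Injective (Sym.toMatrix : Sym 𝕜 n →ₗ[ℝ] _) :=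
  Subtype.val_injective

/-- The operator on Euclidean space with matrix `A`, as a continuous function of `A`. -/
def Sym.toCLM : Sym 𝕜 n →L[ℝ] EuclideanSpace 𝕜 (Fin n) →L[𝕜] EuclideanSpace 𝕜 (Fin n) :=
  LinearMap.toContinuousLinearMap
    ((Matrix.toEuclideanCLM (n := Fin n) (𝕜 := 𝕜)).toAlgEquiv.toLinearMap.restrictScalars ℝ ∘ₗ
      Sym.toMatrix)

theorem Sym.toCLM_apply (A : Sym 𝕜 n) (v : EuclideanSpace 𝕜 (Fin n)) :
    Sym.toCLM A v = Matrix.toEuclideanLin A.toMatrix v := rfl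

theorem eigval_le_add_norm_toCLM (k : Fin n) (A B : Sym 𝕜 n) :
    eigval k A ≤ eigval k B + ‖Sym.toCLM (A - B)‖ := by
  refine eigenvalues_le_eigenvalues_add _ _ _ (fun v => ?_) _
  rw [← Sym.toCLM_apply, ← Sym.toCLM_apply, ← sub_le_iff_le_add', ← map_sub, ← inner_sub_right,
    ← sub_apply, ← map_sub]
  calc
    RCLike.re (inner 𝕜 v (Sym.toCLM (A - B) v)) ≤ ‖v‖ * ‖Sym.toCLM (A - B) v‖ :=
      re_inner_le_norm _ _
    _ ≤ ‖v‖ * (‖Sym.toCLM (A - B)‖ * ‖v‖) := by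
      gcongr
      exact ContinuousLinearMap.le_opNorm _ _
    _ = ‖Sym.toCLM (A - B)‖ * ‖v‖ ^ 2 := by ring

theorem lipschitzWith_eigval (k : Fin n) :
    LipschitzWith ‖(Sym.toCLM : Sym 𝕜 n →L[ℝ] _)‖₊ (eigval k : Sym 𝕜 n → ℝ) :=
  LipschitzWith.of_le_add_mul _ fun A B => (eigval_le_add_norm_toCLM k A B).trans <| by
    rw [dist_eq_norm]
    gcongr
    exact (Sym.toCLM (𝕜 := 𝕜) (n := n)).le_opNorm _

theorem finrank_eigenspace_eq_card (A : Sym 𝕜 n) (μ : ℝ) :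
    Module.finrank 𝕜 (Module.End.eigenspace (Matrix.toLin' A.toMatrix) (μ : 𝕜)) =
      Finset.card {i : Fin n | eigval i A = μ} := by
  have hEuclidean : Module.finrank 𝕜 (Module.End.eigenspace (Matrix.toLin' A.toMatrix) (μ : 𝕜)) =
      Module.finrank 𝕜 (Module.End.eigenspace (Matrix.toEuclideanLin A.toMatrix) (μ : 𝕜)) := by
    refine LinearEquiv.finrank_eq
      ((WithLp.linearEquiv 2 𝕜 (Fin n → 𝕜)).symm.ofSubmodules _ _ ?_)
    ext v
    simp only [Submodule.mem_map_equiv, LinearEquiv.symm_symm, Module.End.mem_eigenspace_iff]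
    rw [← (WithLp.linearEquiv 2 𝕜 (Fin n → 𝕜)).injective.eq_iff]
    rfl
  rw [hEuclidean, ← (Matrix.isSymmetric_toEuclideanLin_iff.mpr
    A.isHermitian).card_filter_eigenvalues_eq finrank_euclideanSpace (μ : 𝕜)]
  symm
  refine Finset.card_equiv (Fin.revPerm.trans (finCongr (Fintype.card_fin n).symm)) fun i => ?_
  simp only [Finset.mem_filter, Finset.mem_univ, true_and, RCLike.ofReal_inj]
  rfl

theorem eventually_eigval_eq_of_finrank_eigenspace_eq (k : Fin n) (A₀ : Sym 𝕜 n) :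
    ∀ᶠ p : Sym 𝕜 n × ℝ in 𝓝 (A₀, eigval k A₀),
      Module.finrank 𝕜 (Module.End.eigenspace (Matrix.toLin' p.1.toMatrix) (p.2 : 𝕜)) =
        eigmult k A₀ → eigval k p.1 = p.2 := by
  have hne : ∀ i : Fin n, ∀ᶠ p : Sym 𝕜 n × ℝ in 𝓝 (A₀, eigval k A₀),
      eigval i p.1 = p.2 → eigval i A₀ = eigval k A₀ := by
    intro i
    by_cases hi : eigval i A₀ = eigval k A₀
    · exact .of_forall fun _ _ => hi
    · have hcont : Continuous fun p : Sym 𝕜 n × ℝ => eigval i p.1 :=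
        (lipschitzWith_eigval i).continuous.comp continuous_fst
      filter_upwards [(hcont.continuousAt.ne_iff_eventually_ne continuousAt_snd).1 hi]
        with p hp hp' using absurd hp' hp
  filter_upwards [Filter.eventually_all.2 hne] with p hp hfin
  rw [eigmult, eigspace, finrank_eigenspace_eq_card, finrank_eigenspace_eq_card] at hfin
  have hsub : Finset.univ.filter (fun i => eigval i p.1 = p.2) ⊆
      Finset.univ.filter fun i => eigval i A₀ = eigval k A₀ :=
    Finset.monotone_filter_right _ fun i _ => hp i
  have hk : k ∈ Finset.univ.filter fun i => eigval i p.1 = p.2 := by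
    rw [Finset.eq_of_subset_of_card_le hsub hfin.ge]
    simp
  simpa using hk

end Eigenvalues

section Bordered

theorem finrank_ker_eq_of_fromBlocks_inverse {R m n p q : Type*} [CommRing R]
    [Fintype m] [Fintype n] [Fintype p] [Fintype q] [DecidableEq m] [DecidableEq n]
    [DecidableEq p] [DecidableEq q]
    {A : Matrix m n R} {B : Matrix m q R} {C : Matrix p n R} {D : Matrix p q R}
    {A' : Matrix n m R} {B' : Matrix n p R} {C' : Matrix q m R} {D' : Matrix q p R}
    (h : Matrix.fromBlocks A B C D * Matrix.fromBlocks A' B' C' D' = 1)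
    (h' : Matrix.fromBlocks A' B' C' D' * Matrix.fromBlocks A B C D = 1) :
    Module.finrank R (LinearMap.ker A.mulVecLin) =
      Module.finrank R (LinearMap.ker D'.mulVecLin) := by
  rw [Matrix.fromBlocks_multiply, ← Matrix.fromBlocks_one, Matrix.fromBlocks_inj] at h h'
  obtain ⟨-, hAB, -, hCD⟩ := h
  obtain ⟨hA'A, -, hC'A, -⟩ := h'
  have hC : ∀ v ∈ LinearMap.ker A.mulVecLin, C *ᵥ v ∈ LinearMap.ker D'.mulVecLin := fun v hv => by
    have hv : A *ᵥ v = 0 := hv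
    simpa [Matrix.add_mulVec, ← Matrix.mulVec_mulVec, hv] using congrArg (· *ᵥ v) hC'A
  have hB' : ∀ u ∈ LinearMap.ker D'.mulVecLin, B' *ᵥ u ∈ LinearMap.ker A.mulVecLin := fun u hu => by
    have hu : D' *ᵥ u = 0 := hu
    simpa [Matrix.add_mulVec, ← Matrix.mulVec_mulVec, hu] using congrArg (· *ᵥ u) hAB
  have hB'C : ∀ v ∈ LinearMap.ker A.mulVecLin, B' *ᵥ C *ᵥ v = v := fun v hv => by
    have hv : A *ᵥ v = 0 := hv
    simpa [Matrix.add_mulVec, ← Matrix.mulVec_mulVec, hv] using congrArg (· *ᵥ v) hA'A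
  have hCB' : ∀ u ∈ LinearMap.ker D'.mulVecLin, C *ᵥ B' *ᵥ u = u := fun u hu => by
    have hu : D' *ᵥ u = 0 := hu
    simpa [Matrix.add_mulVec, ← Matrix.mulVec_mulVec, hu] using congrArg (· *ᵥ u) hCD
  exact LinearEquiv.finrank_eq <| LinearEquiv.ofLinearMap
    (C.mulVecLin.restrict hC) (B'.mulVecLin.restrict hB')
    (LinearMap.ext fun u => Subtype.ext (hCB' u u.2))
    (LinearMap.ext fun v => Subtype.ext (hB'C v v.2))

variable {𝕜 m p : Type*} [RCLike 𝕜]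

/-- The Grushin matrix of `L`, bordered by `U`. -/
def bordered (U : Matrix m p 𝕜) (L : Matrix m m 𝕜) : Matrix (m ⊕ p) (m ⊕ p) 𝕜 :=
  Matrix.fromBlocks L U Uᴴ 0

theorem isHermitian_bordered (U : Matrix m p 𝕜) {L : Matrix m m 𝕜} (hL : L.IsHermitian) :
    (bordered U L).IsHermitian :=
  hL.fromBlocks rfl Matrix.isHermitian_zero

variable [Fintype m] [Fintype p] {U : Matrix m p 𝕜} {L : Matrix m m 𝕜}

theorem mul_eq_zero_of_range_le_ker
    (hUL : LinearMap.range U.mulVecLin ≤ LinearMap.ker L.mulVecLin) : L * U = 0 := by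
  classical
  refine Matrix.toLin'.injective (LinearMap.ext fun w => ?_)
  rw [Matrix.toLin'_mul]
  simpa using hUL ⟨w, rfl⟩

variable [DecidableEq m] [DecidableEq p]

theorem isUnit_bordered (hU : Uᴴ * U = 1) (hL : L.IsHermitian)
    (hUL : LinearMap.range U.mulVecLin = LinearMap.ker L.mulVecLin) : IsUnit (bordered U L) := by
  have hLU : L * U = 0 := mul_eq_zero_of_range_le_ker hUL.le
  have hUL' : Uᴴ * L = 0 := by simpa [hL.eq] using congrArg Matrix.conjTranspose hLU
  rw [← Matrix.mulVec_injective_iff_isUnit, ← Matrix.coe_mulVecLin, injective_iff_map_eq_zero]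
  intro x hx
  have h₁ : L *ᵥ (x ∘ Sum.inl) + U *ᵥ (x ∘ Sum.inr) = 0 := by
    funext i
    simpa [bordered, Matrix.fromBlocks_mulVec] using congrFun hx (Sum.inl i)
  have h₂ : Uᴴ *ᵥ (x ∘ Sum.inl) = 0 := by
    funext i
    simpa [bordered, Matrix.fromBlocks_mulVec] using congrFun hx (Sum.inr i)
  have hr : x ∘ Sum.inr = 0 := by
    simpa [Matrix.mulVec_add, Matrix.mulVec_mulVec, hU, hUL'] using congrArg (Uᴴ *ᵥ ·) h₁
  have hLx : L *ᵥ (x ∘ Sum.inl) = 0 := by simpa [hr] using h₁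
  have hl : x ∘ Sum.inl = 0 := by
    obtain ⟨w, hw⟩ : x ∘ Sum.inl ∈ LinearMap.range U.mulVecLin := hUL ▸ hLx
    rw [Matrix.mulVecLin_apply] at hw
    rw [← hw, Matrix.mulVec_mulVec, hU, Matrix.one_mulVec] at h₂
    rw [← hw, h₂, Matrix.mulVec_zero]
  funext i
  rcases i with i | i
  exacts [congrFun hl i, congrFun hr i]

theorem inv_bordered_eq_fromBlocks (hU : Uᴴ * U = 1) (hL : L.IsHermitian)
    (hUL : LinearMap.range U.mulVecLin = LinearMap.ker L.mulVecLin) :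
    (bordered U L)⁻¹ = Matrix.fromBlocks (bordered U L)⁻¹.toBlocks₁₁ U Uᴴ 0 := by
  have hdet := (Matrix.isUnit_iff_isUnit_det _).1 (isUnit_bordered hU hL hUL)
  have hLU : L * U = 0 := mul_eq_zero_of_range_le_ker hUL.le
  have hUL' : Uᴴ * L = 0 := by simpa [hL.eq] using congrArg Matrix.conjTranspose hLU
  obtain ⟨P, Q, R, S, hinv⟩ : ∃ P Q R S, (bordered U L)⁻¹ = Matrix.fromBlocks P Q R S :=
    ⟨_, _, _, _, (Matrix.fromBlocks_toBlocks _).symm⟩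
  have hleft := Matrix.nonsing_inv_mul _ hdet
  have hright := Matrix.mul_nonsing_inv _ hdet
  rw [hinv, bordered, Matrix.fromBlocks_multiply, ← Matrix.fromBlocks_one,
    Matrix.fromBlocks_inj] at hleft hright
  have hQ : Q = U := by
    simpa [Matrix.add_mul, Matrix.mul_assoc, hLU, hU] using congrArg (· * U) hleft.1
  have hS : S = 0 := by
    simpa [Matrix.add_mul, Matrix.mul_assoc, hLU, hU] using congrArg (· * U) hleft.2.2.1
  have hR : R = Uᴴ := by
    simpa [Matrix.mul_add, ← Matrix.mul_assoc, hUL', hU] using congrArg (Uᴴ * ·) hright.1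
  rw [hinv, Matrix.toBlocks_fromBlocks₁₁, hQ, hR, hS]

theorem finrank_ker_eq_finrank_ker_inv_bordered (h : IsUnit (bordered U L)) :
    Module.finrank 𝕜 (LinearMap.ker L.mulVecLin) =
      Module.finrank 𝕜 (LinearMap.ker (bordered U L)⁻¹.toBlocks₂₂.mulVecLin) := by
  have hdet := (Matrix.isUnit_iff_isUnit_det _).1 h
  have hinv := Matrix.fromBlocks_toBlocks (bordered U L)⁻¹
  refine finrank_ker_eq_of_fromBlocks_inverse (B := U) (C := Uᴴ) (D := 0)
    (A' := (bordered U L)⁻¹.toBlocks₁₁) (B' := (bordered U L)⁻¹.toBlocks₁₂)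
    (C' := (bordered U L)⁻¹.toBlocks₂₁) ?_ ?_
  · rw [hinv]
    exact Matrix.mul_nonsing_inv _ hdet
  · rw [hinv]
    exact Matrix.nonsing_inv_mul _ hdet

end Bordered

section Effective

theorem hasSummableGeomSeries_of_finiteDimensional (𝕂 R : Type*) [NontriviallyNormedField 𝕂]
    [CompleteSpace 𝕂] [NormedRing R] [NormedAlgebra 𝕂 R] [FiniteDimensional 𝕂 R] :
    HasSummableGeomSeries R :=
  have := FiniteDimensional.complete 𝕂 R
  inferInstance

variable {𝕜 : Type*} [RCLike 𝕜] {n ν : ℕ}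

/-- The self-adjoint part of a matrix, as an element of `Sym`; it is the identity on self-adjoint
matrices. -/
def Sym.ofMatrix : Matrix (Fin n) (Fin n) 𝕜 →ₗ[ℝ] Sym 𝕜 n :=
  selfAdjointPart ℝ

theorem Sym.toMatrix_ofMatrix {X : Matrix (Fin n) (Fin n) 𝕜} (hX : X.IsHermitian) :
    (Sym.ofMatrix X).toMatrix = X :=
  IsSelfAdjoint.coe_selfAdjointPart_apply ℝ hX

theorem Sym.ofMatrix_toMatrix (X : Sym 𝕜 n) : Sym.ofMatrix X.toMatrix = X :=
  Sym.toMatrix_injective (Sym.toMatrix_ofMatrix X.isHermitian)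

/-- The effective Hamiltonian of `A` with respect to `U`: the lower right block of the inverse of
the Grushin matrix. -/
def effective (U : Matrix (Fin n) (Fin ν) 𝕜) (A : Sym 𝕜 n) : Sym 𝕜 ν :=
  Sym.ofMatrix (bordered U A.toMatrix)⁻¹.toBlocks₂₂

variable {U : Matrix (Fin n) (Fin ν) 𝕜} {A : Sym 𝕜 n}

theorem toMatrix_effective : (effective U A).toMatrix = (bordered U A.toMatrix)⁻¹.toBlocks₂₂ :=
  Sym.toMatrix_ofMatrix <| (isHermitian_bordered U A.isHermitian).inv.submatrix Sum.inr

theorem effective_eq_zero_iff (h : IsUnit (bordered U A.toMatrix)) :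
    effective U A = 0 ↔ Module.finrank 𝕜 (LinearMap.ker A.toMatrix.mulVecLin) = ν := by
  rw [finrank_ker_eq_finrank_ker_inv_bordered h, ← toMatrix_effective,
    ← map_eq_zero_iff Sym.toMatrix Sym.toMatrix_injective]
  constructor
  · intro h0
    rw [h0, Matrix.mulVecLin_zero, LinearMap.ker_zero, finrank_top, Module.finrank_fin_fun]
  · intro hfin
    refine Matrix.toLin'.injective ?_
    rw [map_zero, ← LinearMap.ker_eq_top, Matrix.toLin'_apply']
    exact Submodule.eq_top_of_finrank_eq (by rw [hfin, Module.finrank_fin_fun])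

/-- The perturbation of the Grushin matrix by a perturbation of its upper left block. -/
def upperLeft : Sym 𝕜 n →ₗ[ℝ] Matrix (Fin n ⊕ Fin ν) (Fin n ⊕ Fin ν) 𝕜 where
  toFun X := Matrix.fromBlocks X.toMatrix 0 0 0
  map_add' X Y := by simp [Matrix.fromBlocks_add]
  map_smul' c X := by simp [Matrix.fromBlocks_smul]

/-- The lower right block of a matrix, as an element of `Sym`. -/
def lowerRight : Matrix (Fin n ⊕ Fin ν) (Fin n ⊕ Fin ν) 𝕜 →ₗ[ℝ] Sym 𝕜 ν :=
  Sym.ofMatrix ∘ₗ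
    { toFun := Matrix.toBlocks₂₂
      map_add' _ _ := rfl
      map_smul' _ _ := rfl }

theorem bordered_toMatrix (U : Matrix (Fin n) (Fin ν) 𝕜) (X : Sym 𝕜 n) :
    bordered U X.toMatrix = upperLeft X + bordered U 0 := by
  simp [upperLeft, bordered, Matrix.fromBlocks_add]

theorem effective_eq_lowerRight_inverse (U : Matrix (Fin n) (Fin ν) 𝕜) :
    effective U = fun X => lowerRight (Ring.inverse (upperLeft X + bordered U 0)) := by
  funext X
  rw [← bordered_toMatrix, ← Matrix.nonsing_inv_eq_ringInverse]
  rfl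

open scoped Matrix.Norms.Frobenius

theorem hasFDerivAt_bordered_toMatrix (U : Matrix (Fin n) (Fin ν) 𝕜) (A : Sym 𝕜 n) :
    HasFDerivAt (fun X : Sym 𝕜 n => upperLeft X + bordered U 0)
      (LinearMap.toContinuousLinearMap (upperLeft (𝕜 := 𝕜) (n := n) (ν := ν))) A :=
  (LinearMap.toContinuousLinearMap (upperLeft (𝕜 := 𝕜) (n := n) (ν := ν))).hasFDerivAt.add_const _

theorem contDiffAt_effective (h : IsUnit (bordered U A.toMatrix)) :
    ContDiffAt ℝ ω (effective U) A := by
  have := hasSummableGeomSeries_of_finiteDimensional ℝ (Matrix (Fin n ⊕ Fin ν) (Fin n ⊕ Fin ν) 𝕜)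
  obtain ⟨u, hu⟩ := h
  rw [bordered_toMatrix] at hu
  rw [effective_eq_lowerRight_inverse]
  have hinv := contDiffAt_ringInverse ℝ (n := ω) u
  rw [hu] at hinv
  exact (LinearMap.toContinuousLinearMap lowerRight).contDiff.contDiffAt.comp A
    (hinv.comp A (((LinearMap.toContinuousLinearMap upperLeft).contDiff.add
      contDiff_const).contDiffAt))

theorem eventually_isUnit_bordered (h : IsUnit (bordered U A.toMatrix)) :
    ∀ᶠ X : Sym 𝕜 n in 𝓝 A, IsUnit (bordered U X.toMatrix) := by
  have := hasSummableGeomSeries_of_finiteDimensional ℝ (Matrix (Fin n ⊕ Fin ν) (Fin n ⊕ Fin ν) 𝕜)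
  simp only [bordered_toMatrix] at h ⊢
  exact (hasFDerivAt_bordered_toMatrix U A).continuousAt.eventually (Units.isOpen.mem_nhds h)

theorem hasFDerivAt_effective (hU : Uᴴ * U = 1)
    (hUA : LinearMap.range U.mulVecLin = LinearMap.ker A.toMatrix.mulVecLin) :
    HasFDerivAt (effective U) (-LinearMap.toContinuousLinearMap (compression U)) A := by
  have := hasSummableGeomSeries_of_finiteDimensional ℝ (Matrix (Fin n ⊕ Fin ν) (Fin n ⊕ Fin ν) 𝕜)
  obtain ⟨u, hu⟩ := isUnit_bordered hU A.isHermitian hUA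
  have hu_inv : (↑u⁻¹ : Matrix (Fin n ⊕ Fin ν) (Fin n ⊕ Fin ν) 𝕜) = _ :=
    (Matrix.coe_units_inv u).trans (hu ▸ inv_bordered_eq_fromBlocks hU A.isHermitian hUA)
  rw [effective_eq_lowerRight_inverse]
  have hinv := hasFDerivAt_ringInverse (𝕜 := ℝ) u
  rw [hu, bordered_toMatrix] at hinv
  refine ((LinearMap.toContinuousLinearMap lowerRight).hasFDerivAt.comp A
    (hinv.comp A (hasFDerivAt_bordered_toMatrix U A))).congr_fderiv
    (ContinuousLinearMap.ext fun X => ?_)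
  change lowerRight (-((u⁻¹).val * upperLeft X * (u⁻¹).val)) = -compression U X
  have hblock : ((u⁻¹).val * upperLeft X * (u⁻¹).val).toBlocks₂₂ = (compression U X).toMatrix := by
    rw [hu_inv]
    change Matrix.toBlocks₂₂ (_ * Matrix.fromBlocks X.toMatrix 0 0 0 * _) = Uᴴ * X.toMatrix * U
    simp [Matrix.fromBlocks_multiply]
  rw [map_neg, ← Sym.ofMatrix_toMatrix (compression U X), ← hblock]
  rfl

end Effective

section LocalEquation

variable {𝕜 : Type*} [RCLike 𝕜] {n ν : ℕ}

instance : One (Sym 𝕜 n) :=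
  inferInstanceAs (One (selfAdjoint (Matrix (Fin n) (Fin n) 𝕜)))

theorem Sym.toMatrix_one : (1 : Sym 𝕜 n).toMatrix = 1 := rfl

theorem compression_one {U : Matrix (Fin n) (Fin ν) 𝕜} (hU : Uᴴ * U = 1) :
    compression U 1 = 1 := by
  apply Sym.toMatrix_injective
  change Uᴴ * (1 : Matrix (Fin n) (Fin n) 𝕜) * U = 1
  rw [Matrix.mul_one, hU]

/-- The Frobenius inner product `(X, Y) ↦ Tr (X Y)` on self-adjoint matrices. -/
def traceForm : LinearMap.BilinForm ℝ (Sym 𝕜 ν) :=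
  LinearMap.mk₂ ℝ (fun X Y => RCLike.re (Matrix.trace (X.toMatrix * Y.toMatrix)))
    (fun X X' Y => by simp [Matrix.add_mul]) (fun c X Y => by simp [RCLike.smul_re])
    (fun X Y Y' => by simp [Matrix.mul_add]) (fun c X Y => by simp [RCLike.smul_re])

theorem traceForm_apply (X Y : Sym 𝕜 ν) :
    traceForm X Y = RCLike.re (Matrix.trace (X.toMatrix * Y.toMatrix)) := rfl

theorem traceForm_one_one : traceForm (1 : Sym 𝕜 ν) 1 = ν := by
  simp [traceForm_apply, Sym.toMatrix_one]

/-- The map `(A, t) ↦ A - t`. -/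
def shift : Sym 𝕜 n × ℝ →L[ℝ] Sym 𝕜 n :=
  ContinuousLinearMap.fst ℝ _ _ - (ContinuousLinearMap.snd ℝ _ _).smulRight 1

theorem shift_apply (A : Sym 𝕜 n) (t : ℝ) : shift (A, t) = A - t • 1 := rfl

theorem ker_toMatrix_shift (A : Sym 𝕜 n) (t : ℝ) :
    LinearMap.ker (shift (A, t)).toMatrix.mulVecLin =
      Module.End.eigenspace (Matrix.toLin' A.toMatrix) (t : 𝕜) := by
  ext v
  rw [LinearMap.mem_ker, Module.End.mem_eigenspace_iff, Matrix.mulVecLin_apply, shift_apply,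
    map_sub, map_smul, Sym.toMatrix_one, Matrix.sub_mulVec, sub_eq_zero, Matrix.smul_mulVec,
    Matrix.one_mulVec, Matrix.toLin'_apply, RCLike.real_smul_eq_coe_smul (K := 𝕜)]

theorem effective_shift_eq_zero_iff {U : Matrix (Fin n) (Fin ν) 𝕜} {A : Sym 𝕜 n} {t : ℝ}
    (h : IsUnit (bordered U (shift (A, t)).toMatrix)) :
    effective U (shift (A, t)) = 0 ↔
      Module.finrank 𝕜 (Module.End.eigenspace (Matrix.toLin' A.toMatrix) (t : 𝕜)) = ν := by
  rw [effective_eq_zero_iff h, ker_toMatrix_shift]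

theorem eigmult_pos (k : Fin n) (A : Sym 𝕜 n) : 0 < eigmult k A := by
  rw [eigmult, eigspace, finrank_eigenspace_eq_card]
  exact Finset.card_pos.2 ⟨k, by simp⟩

variable {k : Fin n} {A₀ : Sym 𝕜 n} {U : Matrix (Fin n) (Fin ν) 𝕜}

theorem IsIsometryOnto.finrank_eq {E : Submodule 𝕜 (Fin n → 𝕜)} (hU : IsIsometryOnto U E) :
    Module.finrank 𝕜 E = ν := by
  have hinj : Function.Injective U.mulVecLin := fun v w h => by
    simpa [Matrix.mulVec_mulVec, hU.1] using congrArg (Uᴴ *ᵥ ·) h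
  rw [← hU.2, LinearMap.finrank_range_of_inj hinj, Module.finrank_fin_fun]

theorem IsIsometryOnto.pos (hU : IsIsometryOnto U (eigspace k A₀)) : 0 < ν :=
  (eigmult_pos k A₀).trans_eq hU.finrank_eq

theorem IsIsometryOnto.range_eq_ker_shift (hU : IsIsometryOnto U (eigspace k A₀)) :
    LinearMap.range U.mulVecLin =
      LinearMap.ker (shift (A₀, eigval k A₀)).toMatrix.mulVecLin := by
  rw [hU.2, ker_toMatrix_shift, eigspace]

theorem IsIsometryOnto.isUnit_bordered_shift (hU : IsIsometryOnto U (eigspace k A₀)) :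
    IsUnit (bordered U (shift (A₀, eigval k A₀)).toMatrix) :=
  isUnit_bordered hU.1 (Sym.isHermitian _) hU.range_eq_ker_shift

theorem IsIsometryOnto.effective_shift_eq_zero (hU : IsIsometryOnto U (eigspace k A₀)) :
    effective U (shift (A₀, eigval k A₀)) = 0 :=
  (effective_shift_eq_zero_iff hU.isUnit_bordered_shift).2 hU.finrank_eq

theorem IsIsometryOnto.contDiffAt_effective_shift (hU : IsIsometryOnto U (eigspace k A₀)) :
    ContDiffAt ℝ ω (fun p => effective U (shift p)) (A₀, eigval k A₀) :=
  (contDiffAt_effective hU.isUnit_bordered_shift).comp _ shift.contDiff.contDiffAt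

theorem IsIsometryOnto.hasFDerivAt_effective_shift (hU : IsIsometryOnto U (eigspace k A₀)) :
    HasFDerivAt (fun p => effective U (shift p))
      (-LinearMap.toContinuousLinearMap (compression U) ∘L shift) (A₀, eigval k A₀) :=
  (hasFDerivAt_effective hU.1 hU.range_eq_ker_shift).comp (A₀, eigval k A₀) shift.hasFDerivAt

theorem IsIsometryOnto.exists_traceForm_effective_eq_zero_iff
    (hU : IsIsometryOnto U (eigspace k A₀)) :
    ∃ μ : Sym 𝕜 n → ℝ, ContDiffAt ℝ ω μ A₀ ∧ μ A₀ = eigval k A₀ ∧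
      (∀ᶠ A in 𝓝 A₀, traceForm 1 (effective U (shift (A, μ A))) = 0) ∧
      ∀ᶠ p in 𝓝 (A₀, eigval k A₀), traceForm 1 (effective U (shift p)) = 0 ↔ μ p.1 = p.2 := by
  have hν : (ν : ℝ) ≠ 0 := Nat.cast_ne_zero.2 hU.pos.ne'
  let τ : Sym 𝕜 ν →L[ℝ] ℝ := LinearMap.toContinuousLinearMap (traceForm 1)
  have hg : ContDiffAt ℝ ω (fun p => τ (effective U (shift p))) (A₀, eigval k A₀) :=
    τ.contDiff.contDiffAt.comp _ hU.contDiffAt_effective_shift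
  have hg' : HasFDerivAt (fun p => τ (effective U (shift p))) _ (A₀, eigval k A₀) :=
    τ.hasFDerivAt.comp _ hU.hasFDerivAt_effective_shift
  have hpartial : fderiv ℝ (fun p => τ (effective U (shift p))) (A₀, eigval k A₀) ∘L .inr ℝ _ _ =
      ContinuousLinearEquiv.unitsEquivAut ℝ (Units.mk0 (ν : ℝ) hν) := by
    refine ContinuousLinearMap.ext_ring ?_
    rw [hg'.fderiv]
    change traceForm 1 (-compression U (0 - (1 : ℝ) • 1)) = (1 : ℝ) * ν
    rw [one_smul, zero_sub, map_neg, map_neg, map_neg, neg_neg, compression_one hU.1,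
      traceForm_one_one, one_mul]
  have hinv : (fderiv ℝ (fun p => τ (effective U (shift p))) (A₀, eigval k A₀) ∘L
      .inr ℝ _ _).IsInvertible := ⟨_, hpartial.symm⟩
  have h0 : τ (effective U (shift (A₀, eigval k A₀))) = 0 := by
    rw [hU.effective_shift_eq_zero, map_zero]
  refine ⟨hg.implicitFunction (by simp) hinv, hg.contDiffAt_implicitFunction _ hinv,
    hg.implicitFunction_apply_self _ hinv, ?_, ?_⟩
  · have h := hg.eventually_apply_implicitFunction (by simp) hinv
    rw [h0] at h
    exact h
  · have h := hg.eventually_apply_eq_iff_implicitFunction (by simp) hinv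
    rw [h0] at h
    exact h

theorem IsIsometryOnto.hasFDerivAt_effective_graph (hU : IsIsometryOnto U (eigspace k A₀))
    {μ : Sym 𝕜 n → ℝ} {μ' : Sym 𝕜 n →L[ℝ] ℝ} (hμ : HasFDerivAt μ μ' A₀)
    (hμ0 : μ A₀ = eigval k A₀) :
    HasFDerivAt (fun A => effective U (shift (A, μ A)))
      (μ'.smulRight 1 - LinearMap.toContinuousLinearMap (compression U)) A₀ := by
  have h := hU.hasFDerivAt_effective_shift
  rw [← hμ0] at h
  refine (h.comp A₀ ((hasFDerivAt_id A₀).prodMk hμ)).congr_fderiv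
    (ContinuousLinearMap.ext fun X => ?_)
  change -compression U (X - μ' X • 1) = μ' X • 1 - compression U X
  rw [map_sub, map_smul, compression_one hU.1, neg_sub]

instance : IsClosed (Submodule.span ℝ {(1 : Sym 𝕜 ν)} : Set (Sym 𝕜 ν)) :=
  Submodule.closed_of_finiteDimensional _

/-- `Sym_ν` modulo the scalar matrices, the space in which the equation of the stratum takes its
values. -/
abbrev SymModScalars (𝕜 : Type*) [RCLike 𝕜] (ν : ℕ) : Type _ :=
  Sym 𝕜 ν ⧸ Submodule.span ℝ {(1 : Sym 𝕜 ν)}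

/-- The reduction of a self-adjoint matrix modulo the scalar matrices. -/
def modScalars : Sym 𝕜 ν →L[ℝ] SymModScalars 𝕜 ν :=
  (Submodule.span ℝ {1}).mkQL

theorem modScalars_eq_zero_iff {X : Sym 𝕜 ν} : modScalars X = 0 ↔ ∃ c : ℝ, c • 1 = X :=
  (Submodule.Quotient.mk_eq_zero _).trans Submodule.mem_span_singleton

theorem modScalars_smul_one (c : ℝ) : modScalars (c • 1 : Sym 𝕜 ν) = 0 :=
  modScalars_eq_zero_iff.2 ⟨c, rfl⟩

theorem Sym.one_ne_zero (hν : 0 < ν) : (1 : Sym 𝕜 ν) ≠ 0 := fun h => by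
  have h1 := traceForm_one_one (𝕜 := 𝕜) (ν := ν)
  rw [h, map_zero, eq_comm, Nat.cast_eq_zero] at h1
  exact hν.ne' h1

theorem finrank_symModScalars (hν : 0 < ν) :
    Module.finrank ℝ (SymModScalars 𝕜 ν) = stratumCodim 𝕜 ν := by
  rw [stratumCodim, ← finrank_span_singleton (K := ℝ) (Sym.one_ne_zero (𝕜 := 𝕜) hν),
    Submodule.finrank_quotient]

theorem IsIsometryOnto.eventually_eigmult_eq_iff (hU : IsIsometryOnto U (eigspace k A₀))
    {μ : Sym 𝕜 n → ℝ} (hμ : ContinuousAt μ A₀) (hμ0 : μ A₀ = eigval k A₀)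
    (hμ_iff : ∀ᶠ p in 𝓝 (A₀, eigval k A₀),
      traceForm 1 (effective U (shift p)) = 0 ↔ μ p.1 = p.2) :
    ∀ᶠ A in 𝓝 A₀, (eigmult k A = ν ↔ effective U (shift (A, μ A)) = 0) ∧
      (eigmult k A = ν → eigval k A = μ A) := by
  have hunit : ∀ᶠ p in 𝓝 (A₀, eigval k A₀), IsUnit (bordered U (shift p).toMatrix) :=
    shift.continuous.continuousAt.eventually (eventually_isUnit_bordered hU.isUnit_bordered_shift)
  have hgraph : Filter.Tendsto (fun A => (A, μ A)) (𝓝 A₀) (𝓝 (A₀, eigval k A₀)) :=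
    hμ0 ▸ continuousAt_id.prodMk hμ
  have heig : Filter.Tendsto (fun A => (A, eigval k A)) (𝓝 A₀) (𝓝 (A₀, eigval k A₀)) :=
    continuousAt_id.prodMk (lipschitzWith_eigval k).continuous.continuousAt
  filter_upwards [hgraph.eventually hunit, heig.eventually hunit, heig.eventually hμ_iff,
    hgraph.eventually (eventually_eigval_eq_of_finrank_eigenspace_eq k A₀)]
    with A hunit_μ hunit_eig hA_iff heigval
  have heq : eigmult k A = ν → eigval k A = μ A := fun h =>
    (hA_iff.1 (by rw [(effective_shift_eq_zero_iff hunit_eig).2 h, map_zero])).symm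
  refine ⟨⟨fun h => ?_, fun h => ?_⟩, heq⟩
  · rw [effective_shift_eq_zero_iff hunit_μ, ← heq h]
    exact h
  · have hfin := (effective_shift_eq_zero_iff hunit_μ).1 h
    rw [eigmult, eigspace, heigval (hfin.trans hU.finrank_eq.symm)]
    exact hfin

theorem IsIsometryOnto.fderiv_mul_eq_traceForm (hU : IsIsometryOnto U (eigspace k A₀))
    {μ : Sym 𝕜 n → ℝ} {μ' : Sym 𝕜 n →L[ℝ] ℝ} (hμ : HasFDerivAt μ μ' A₀)
    (hμ0 : μ A₀ = eigval k A₀)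
    (hμ_zero : ∀ᶠ A in 𝓝 A₀, traceForm 1 (effective U (shift (A, μ A))) = 0) (X : Sym 𝕜 n) :
    μ' X * ν = traceForm 1 (compression U X) := by
  have h := (LinearMap.toContinuousLinearMap (traceForm (1 : Sym 𝕜 ν))).hasFDerivAt.comp A₀
    (hU.hasFDerivAt_effective_graph hμ hμ0)
  have h0 := h.unique ((hasFDerivAt_const (0 : ℝ) A₀).congr_of_eventuallyEq hμ_zero)
  have hX : traceForm 1 (μ' X • 1 - compression U X) = 0 := DFunLike.congr_fun h0 X
  rwa [map_sub, map_smul, traceForm_one_one, sub_eq_zero, smul_eq_mul] at hX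

theorem modScalars_eq_zero_iff_of_traceForm_eq_zero (hν : 0 < ν) {X : Sym 𝕜 ν}
    (hX : traceForm 1 X = 0) : modScalars X = 0 ↔ X = 0 := by
  refine ⟨fun h => ?_, fun h => by rw [h, map_zero]⟩
  obtain ⟨c, rfl⟩ := modScalars_eq_zero_iff.1 h
  rw [map_smul, traceForm_one_one, smul_eq_mul] at hX
  rw [(mul_eq_zero.1 hX).resolve_right (Nat.cast_ne_zero.2 hν.ne'), zero_smul]

theorem IsIsometryOnto.exists_stratum_equation (hU : IsIsometryOnto U (eigspace k A₀)) :
    ∃ (μ : Sym 𝕜 n → ℝ) (Φ : Sym 𝕜 n → SymModScalars 𝕜 ν),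
      ContDiffAt ℝ ω μ A₀ ∧ ContDiffAt ℝ ω Φ A₀ ∧
      (∀ X c, compression U X = c • 1 → fderiv ℝ μ A₀ X = c) ∧
      (∀ X, fderiv ℝ Φ A₀ X = modScalars (compression U X)) ∧
      ∀ᶠ A in 𝓝 A₀, (eigmult k A = ν ↔ Φ A = 0) ∧ (eigmult k A = ν → eigval k A = μ A) := by
  obtain ⟨μ, hμ, hμ0, hμ_zero, hμ_iff⟩ := hU.exists_traceForm_effective_eq_zero_iff
  have hμ' : HasFDerivAt μ (fderiv ℝ μ A₀) A₀ := (hμ.differentiableAt (by simp)).hasFDerivAt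
  have heff : ContDiffAt ℝ ω (fun A => effective U (shift (A, μ A))) A₀ :=
    ContDiffAt.comp A₀ (g := fun p => effective U (shift p))
      (by rw [hμ0]; exact hU.contDiffAt_effective_shift) (contDiffAt_id.prodMk hμ)
  refine ⟨μ, fun A => modScalars (-effective U (shift (A, μ A))), hμ,
    modScalars.contDiff.contDiffAt.comp A₀ heff.neg, fun X c hX => ?_, fun X => ?_, ?_⟩
  · have h := hU.fderiv_mul_eq_traceForm hμ' hμ0 hμ_zero X
    rw [hX, map_smul, traceForm_one_one, smul_eq_mul] at h
    exact mul_right_cancel₀ (Nat.cast_ne_zero.2 hU.pos.ne') h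
  · have h : HasFDerivAt (fun A => modScalars (-effective U (shift (A, μ A)))) _ A₀ :=
      modScalars.hasFDerivAt.comp A₀ (hU.hasFDerivAt_effective_graph hμ' hμ0).neg
    rw [h.fderiv]
    change modScalars (-(fderiv ℝ μ A₀ X • 1 - compression U X)) = _
    rw [neg_sub, map_sub, modScalars_smul_one, sub_zero]
  · filter_upwards [hμ_zero, hU.eventually_eigmult_eq_iff hμ.continuousAt hμ0 hμ_iff]
      with A hA_zero ⟨hA_iff, hA_eq⟩
    rw [map_neg, neg_eq_zero, modScalars_eq_zero_iff_of_traceForm_eq_zero hU.pos hA_zero]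
    exact ⟨hA_iff, hA_eq⟩

end LocalEquation

section RegularLevelSet

variable {𝕜 E K V : Type*} [RCLike 𝕜] {n : ℕ∞ω}
  [NormedAddCommGroup E] [NormedSpace 𝕜 E] [NormedAddCommGroup K] [NormedSpace 𝕜 K]
  [NormedAddCommGroup V] [NormedSpace 𝕜 V]

theorem exists_continuousLinearEquiv_snd_eq_of_surjective [FiniteDimensional 𝕜 E]
    [FiniteDimensional 𝕜 V] (f : E →L[𝕜] V) (hf : Function.Surjective f) :
    ∃ (m : ℕ) (L : E ≃L[𝕜] EuclideanSpace 𝕜 (Fin m) × V),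
      m + Module.finrank 𝕜 V = Module.finrank 𝕜 E ∧ ∀ v, (L v).2 = f v := by
  obtain ⟨g, hg⟩ := f.toLinearMap.exists_rightInverse_of_surjective (LinearMap.range_eq_top.2 hf)
  let e := ContinuousLinearEquiv.equivOfRightInverse f g.toContinuousLinearMap
    (LinearMap.congr_fun hg)
  let i : f.ker ≃L[𝕜] EuclideanSpace 𝕜 (Fin (Module.finrank 𝕜 f.ker)) :=
    ContinuousLinearEquiv.ofFinrankEq finrank_euclideanSpace_fin.symm
  have hdim := e.toLinearEquiv.finrank_eq
  rw [Module.finrank_prod, add_comm] at hdim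
  exact ⟨_, (e.trans (.prodComm 𝕜 V f.ker)).trans (i.prodCongr (.refl 𝕜 V)), hdim.symm,
    fun v => rfl⟩

theorem exists_openPartialHomeomorph_contDiffOn_symm [CompleteSpace E] (hn : n ≠ 0) {f : E → V}
    {O : Set E} (hO : IsOpen O) (hf : ContDiffOn 𝕜 n f O) {a : E} (ha : a ∈ O) {f' : E ≃L[𝕜] V}
    (hf' : HasFDerivAt f (f' : E →L[𝕜] V) a) :
    ∃ e : OpenPartialHomeomorph E V, a ∈ e.source ∧ e.source ⊆ O ∧ (e : E → V) = f ∧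
      ContDiffOn 𝕜 n e.symm e.target := by
  have hfO : ∀ x ∈ O, ContDiffAt 𝕜 n f x := fun x hx => hf.contDiffAt (hO.mem_nhds hx)
  let e₀ := (hfO a ha).toOpenPartialHomeomorph f hf' hn
  let W : Set E := O ∩ fderiv 𝕜 f ⁻¹' Set.range ((↑) : (E ≃L[𝕜] V) → E →L[𝕜] V)
  have hW : IsOpen W :=
    (hf.continuousOn_fderiv_of_isOpen hO
      (ENat.one_le_iff_ne_zero_withTop.2 hn)).isOpen_inter_preimage hO ContinuousLinearEquiv.isOpen
  have hsource : (e₀.restrOpen W hW).source ⊆ W := Set.inter_subset_right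
  refine ⟨e₀.restrOpen W hW, ⟨ContDiffAt.mem_toOpenPartialHomeomorph_source _ _ _, ha, f',
    hf'.fderiv.symm⟩, hsource.trans Set.inter_subset_left, rfl, fun y hy => ?_⟩
  obtain ⟨hxO, g, hg⟩ := hsource ((e₀.restrOpen W hW).map_target hy)
  refine ((e₀.restrOpen W hW).contDiffAt_symm (f₀' := g) hy ?_ (hfO _ hxO)).contDiffWithinAt
  rw [hg]
  exact ((hfO _ hxO).differentiableAt hn).hasFDerivAt

theorem exists_openPartialHomeomorph_snd_eq [CompleteSpace E] (hn : n ≠ 0) {f : E → V} {O : Set E}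
    (hO : IsOpen O) (hf : ContDiffOn 𝕜 n f O) {a : E} (ha : a ∈ O) (L : E ≃L[𝕜] K × V)
    (hL : ∀ v, (L v).2 = fderiv 𝕜 f a v) :
    ∃ e : OpenPartialHomeomorph E E, a ∈ e.source ∧ e.source ⊆ O ∧ (∀ y, (L (e y)).2 = f y) ∧
      ContDiffOn 𝕜 n e e.source ∧ ContDiffOn 𝕜 n e.symm e.target := by
  let θ : E → E := fun y => L.symm ((L y).1, f y)
  have hθ : ContDiffOn 𝕜 n θ O :=
    L.symm.contDiff.comp_contDiffOn ((contDiff_fst.comp L.contDiff).contDiffOn.prodMk hf)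
  have hθ' : HasFDerivAt θ (ContinuousLinearEquiv.refl 𝕜 E : E →L[𝕜] E) a := by
    have hfa := ((hf.contDiffAt (hO.mem_nhds ha)).differentiableAt hn).hasFDerivAt
    refine (L.symm.hasFDerivAt.comp a
      ((hasFDerivAt_fst.comp a L.hasFDerivAt).prodMk hfa)).congr_fderiv
      (ContinuousLinearMap.ext fun v => ?_)
    change L.symm ((L v).1, fderiv 𝕜 f a v) = v
    rw [← hL, L.symm_apply_apply]
  obtain ⟨e, hae, heO, he, he_symm⟩ := exists_openPartialHomeomorph_contDiffOn_symm hn hO hθ ha hθ'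
  refine ⟨e, hae, heO, fun y => ?_, he ▸ hθ.mono heO, he_symm⟩
  rw [he, L.apply_symm_apply]

variable {M : Type*} [TopologicalSpace M]

theorem isOpenEmbedding_fst_of_slice (L : E ≃L[𝕜] K × V) {φ : OpenPartialHomeomorph M E}
    {S : Set M} (hS : ∀ y, y ∈ S ↔ y ∈ φ.source ∧ (L (φ y)).2 = 0) :
    Topology.IsOpenEmbedding fun y : S => (L (φ y)).1 := by
  have hSφ : S ⊆ φ.source := fun y hy => ((hS y).1 hy).1
  let c : S → K := fun y => (L (φ y)).1
  let j : K → E := fun u => L.symm (u, 0)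
  have hj : Continuous j := L.symm.continuous.comp (continuous_id.prodMk continuous_const)
  have hjc : j ∘ c = fun y : S => φ y :=
    funext fun y => L.symm_apply_eq.2 (Prod.ext rfl ((hS y).1 y.2).2.symm)
  have hφS : Topology.IsEmbedding fun y : S => φ y :=
    φ.isOpenEmbedding_restrict.isEmbedding.comp (.inclusion hSφ)
  have hc : Continuous c := continuous_fst.comp (L.continuous.comp hφS.continuous)
  suffices Set.range c = j ⁻¹' φ.target from
    ⟨.of_comp hc hj (hjc ▸ hφS), this ▸ φ.open_target.preimage hj⟩
  refine Set.Subset.antisymm ?_ fun u hu => ?_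
  · rintro _ ⟨y, rfl⟩
    exact Set.mem_preimage.2 (Set.mem_of_eq_of_mem (congrFun hjc y) (φ.map_source (hSφ y.2)))
  · have hLu : L (φ (φ.symm (j u))) = (u, 0) := by rw [φ.right_inv hu, L.apply_symm_apply]
    exact ⟨⟨φ.symm (j u), (hS _).2 ⟨φ.map_target hu, congrArg Prod.snd hLu⟩⟩,
      congrArg Prod.fst hLu⟩

variable [ChartedSpace E M]

theorem fderiv_comp_chartAt_symm {Ψ : M → V} {x : M}
    (hΨ : MDifferentiableAt 𝓘(𝕜, E) 𝓘(𝕜, V) Ψ x) :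
    fderiv 𝕜 (Ψ ∘ (chartAt E x).symm) (chartAt E x x) = mfderiv 𝓘(𝕜, E) 𝓘(𝕜, V) Ψ x := by
  rw [hΨ.mfderiv, ModelWithCorners.range_eq_univ, fderivWithin_univ]
  rfl

theorem trans_mem_maximalAtlas [IsManifold 𝓘(𝕜, E) n M] {χ : OpenPartialHomeomorph M E}
    (hχ : χ ∈ IsManifold.maximalAtlas 𝓘(𝕜, E) n M) {e : OpenPartialHomeomorph E E}
    (he : ContDiffOn 𝕜 n e e.source) (he_symm : ContDiffOn 𝕜 n e.symm e.target) :
    χ.trans e ∈ IsManifold.maximalAtlas 𝓘(𝕜, E) n M :=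
  (χ.trans e).mem_maximalAtlas_of_contMDiffOn
    (he.contMDiffOn.comp ((contMDiffOn_of_mem_maximalAtlas hχ).mono fun _ hy => hy.1)
      fun _ hy => hy.2)
    ((contMDiffOn_symm_of_mem_maximalAtlas hχ).comp (he_symm.contMDiffOn.mono fun _ hy => hy.1)
      fun _ hy => hy.2)

theorem exists_mem_maximalAtlas_snd_eq [CompleteSpace E] [IsManifold 𝓘(𝕜, E) n M] (hn : n ≠ 0)
    {Ψ : M → V} {O : Set M} (hO : IsOpen O) (hΨ : ContMDiffOn 𝓘(𝕜, E) 𝓘(𝕜, V) n Ψ O) {x : M}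
    (hx : x ∈ O) (L : E ≃L[𝕜] K × V) (hL : ∀ v : E, (L v).2 = mfderiv 𝓘(𝕜, E) 𝓘(𝕜, V) Ψ x v) :
    ∃ φ ∈ IsManifold.maximalAtlas 𝓘(𝕜, E) n M,
      x ∈ φ.source ∧ φ.source ⊆ O ∧ ∀ y ∈ φ.source, (L (φ y)).2 = Ψ y := by
  let χ := chartAt E x
  have hχ : χ ∈ IsManifold.maximalAtlas 𝓘(𝕜, E) n M := IsManifold.chart_mem_maximalAtlas x
  have hxχ : x ∈ χ.source := mem_chart_source E x
  have hΩ : IsOpen (χ.target ∩ χ.symm ⁻¹' O) := χ.symm.isOpen_inter_preimage hO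
  have hf : ContDiffOn 𝕜 n (Ψ ∘ χ.symm) (χ.target ∩ χ.symm ⁻¹' O) :=
    (hΨ.comp ((contMDiffOn_symm_of_mem_maximalAtlas hχ).mono Set.inter_subset_left)
      fun y hy => hy.2).contDiffOn
  have hxΩ : χ x ∈ χ.target ∩ χ.symm ⁻¹' O :=
    ⟨χ.map_source hxχ, by rwa [Set.mem_preimage, χ.left_inv hxχ]⟩
  rw [← fderiv_comp_chartAt_symm ((hΨ.contMDiffAt (hO.mem_nhds hx)).mdifferentiableAt hn)] at hL
  obtain ⟨e, hxe, heΩ, heΨ, he, he_symm⟩ := exists_openPartialHomeomorph_snd_eq hn hΩ hf hxΩ L hL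
  refine ⟨χ.trans e, trans_mem_maximalAtlas hχ he he_symm, ⟨hxχ, hxe⟩, fun y hy => ?_,
    fun y hy => ?_⟩
  · have hyO := (heΩ hy.2).2
    rwa [Set.mem_preimage, OpenPartialHomeomorph.symm_symm, χ.left_inv hy.1] at hyO
  · rw [OpenPartialHomeomorph.trans_apply, heΨ, Function.comp_apply, χ.left_inv hy.1]

theorem exists_isSmoothEmbedding_of_slice (L : E ≃L[𝕜] K × V) {φ : OpenPartialHomeomorph M E}
    (hφ : φ ∈ IsManifold.maximalAtlas 𝓘(𝕜, E) n M) {S : Set M} (hne : S.Nonempty)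
    (hS : ∀ y, y ∈ S ↔ y ∈ φ.source ∧ (L (φ y)).2 = 0) :
    ∃ _ : ChartedSpace K S, IsManifold 𝓘(𝕜, K) n S ∧
      Manifold.IsSmoothEmbedding 𝓘(𝕜, K) 𝓘(𝕜, E) n (Subtype.val : S → M) := by
  have : Nonempty S := hne.to_subtype
  have hc := isOpenEmbedding_fst_of_slice L hS
  let c := hc.toOpenPartialHomeomorph _
  let _ : ChartedSpace K S := hc.singletonChartedSpace
  have hS_manifold : IsManifold 𝓘(𝕜, K) n S := hc.isManifold_singleton
  refine ⟨inferInstance, hS_manifold, ?_, .subtypeVal⟩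
  refine Manifold.IsImmersionOfComplement.isImmersion (F := V) fun y =>
    .mk_of_continuousAt continuous_subtype_val.continuousAt L.symm c φ (Set.mem_univ y)
      ((hS y).1 y.2).1 (IsManifold.subset_maximalAtlas rfl) hφ fun u hu => ?_
  obtain ⟨z, rfl⟩ : u ∈ Set.range fun y : S => (L (φ y)).1 := by simpa [c] using hu
  have hz : c.symm (L (φ z)).1 = z := c.left_inv (Set.mem_univ z)
  change φ (c.symm (L (φ z)).1) = L.symm ((L (φ z)).1, 0)
  rw [hz, L.eq_symm_apply]
  exact Prod.ext rfl ((hS z).1 z.2).2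

theorem exists_isSmoothEmbedding_zeroSet [FiniteDimensional 𝕜 E] [FiniteDimensional 𝕜 V]
    [IsManifold 𝓘(𝕜, E) n M] (hn : n ≠ 0) {Ψ : M → V} {O : Set M} (hO : IsOpen O)
    (hΨ : ContMDiffOn 𝓘(𝕜, E) 𝓘(𝕜, V) n Ψ O) {x : M} (hx : x ∈ O) (hΨx : Ψ x = 0)
    (hsurj : Function.Surjective (mfderiv 𝓘(𝕜, E) 𝓘(𝕜, V) Ψ x)) :
    ∃ (W : Set M) (m : ℕ), IsOpen W ∧ x ∈ W ∧ W ⊆ O ∧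
      m + Module.finrank 𝕜 V = Module.finrank 𝕜 E ∧
      ∃ _ : ChartedSpace (EuclideanSpace 𝕜 (Fin m)) {y | y ∈ W ∧ Ψ y = 0},
        IsManifold 𝓘(𝕜, EuclideanSpace 𝕜 (Fin m)) n {y | y ∈ W ∧ Ψ y = 0} ∧
        Manifold.IsSmoothEmbedding 𝓘(𝕜, EuclideanSpace 𝕜 (Fin m)) 𝓘(𝕜, E) n
          (Subtype.val : {y | y ∈ W ∧ Ψ y = 0} → M) := by
  have := FiniteDimensional.complete 𝕜 E
  obtain ⟨m, L, hm, hL⟩ :=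
    exists_continuousLinearEquiv_snd_eq_of_surjective (E := E) (V := V) _ hsurj
  obtain ⟨φ, hφ, hxφ, hφO, hφΨ⟩ := exists_mem_maximalAtlas_snd_eq hn hO hΨ hx L hL
  exact ⟨φ.source, m, φ.open_source, hxφ, hφO, hm, exists_isSmoothEmbedding_of_slice L hφ
    ⟨x, hxφ, hΨx⟩ fun y => and_congr_right fun hy => by rw [hφΨ y hy]⟩

end RegularLevelSet

section Criticality

variable {𝕜 : Type*} [RCLike 𝕜] {n ν : ℕ}

theorem coe_traceForm (X Y : Sym 𝕜 ν) :
    ((traceForm X Y : ℝ) : 𝕜) = Matrix.trace (X.toMatrix * Y.toMatrix) := by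
  rw [traceForm_apply, ← RCLike.conj_eq_iff_re, starRingEnd_apply, ← Matrix.trace_conjTranspose,
    Matrix.conjTranspose_mul, X.isHermitian.eq, Y.isHermitian.eq, Matrix.trace_mul_comm]

theorem traceForm_isSymm : (traceForm : LinearMap.BilinForm ℝ (Sym 𝕜 ν)).IsSymm :=
  ⟨fun X Y => by simp only [traceForm_apply, Matrix.trace_mul_comm X.toMatrix]⟩

theorem traceForm_self_eq_zero_iff {X : Sym 𝕜 ν} : traceForm X X = 0 ↔ X = 0 := by
  rw [← RCLike.ofReal_eq_zero (K := 𝕜), coe_traceForm]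
  nth_rewrite 1 [← X.isHermitian.eq]
  rw [Matrix.trace_conjTranspose_mul_self_eq_zero_iff,
    map_eq_zero_iff Sym.toMatrix Sym.toMatrix_injective]

theorem traceForm_nondegenerate :
    (traceForm : LinearMap.BilinForm ℝ (Sym 𝕜 ν)).Nondegenerate :=
  ⟨fun X hX => traceForm_self_eq_zero_iff.1 (hX X),
    fun X hX => traceForm_self_eq_zero_iff.1 (hX X)⟩

theorem frobeniusPerp_eq_orthogonal (V : Submodule ℝ (Sym 𝕜 ν)) :
    frobeniusPerp V = traceForm.orthogonal V := by
  ext Y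
  exact forall₂_congr fun X _ => by rw [← coe_traceForm, RCLike.ofReal_eq_zero]

theorem eq_ker_traceForm_of_frobeniusPerp_eq_span {V : Submodule ℝ (Sym 𝕜 ν)} {B : Sym 𝕜 ν}
    (h : frobeniusPerp V = Submodule.span ℝ {B}) : V = LinearMap.ker (traceForm B) := by
  rw [← LinearMap.BilinForm.orthogonal_orthogonal traceForm_nondegenerate traceForm_isSymm.isRefl V,
    ← frobeniusPerp_eq_orthogonal V, h]
  exact LinearMap.BilinForm.orthogonal_span_singleton_eq_toLin_ker B

theorem isCompl_ker_span_singleton {R W : Type*} [Field R] [AddCommGroup W] [Module R W]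
    {f : W →ₗ[R] R} {w : W} (h : f w ≠ 0) : IsCompl (LinearMap.ker f) (Submodule.span R {w}) :=
  Submodule.isCompl_span_singleton_of_isCoatom_of_notMem
    (LinearMap.isCoatom_ker_of_surjective (LinearMap.surjective fun hf => h (by rw [hf]; rfl))) h

theorem isCompl_span_one_of_frobeniusPerp_eq_span (hν : 0 < ν) {V : Submodule ℝ (Sym 𝕜 ν)}
    {B : Sym 𝕜 ν} (hB : B.toMatrix.PosDef) (h : frobeniusPerp V = Submodule.span ℝ {B}) :
    IsCompl V (Submodule.span ℝ {1}) := by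
  have : Nonempty (Fin ν) := ⟨⟨0, hν⟩⟩
  rw [eq_ker_traceForm_of_frobeniusPerp_eq_span h]
  refine isCompl_ker_span_singleton (ne_of_gt ?_)
  rw [traceForm_apply, Sym.toMatrix_one, Matrix.mul_one]
  exact (RCLike.pos_iff.1 hB.trace_pos).1

variable {d : ℕ} {M : Type*} [TopologicalSpace M] [ChartedSpace (EuclideanSpace ℝ (Fin d)) M]
  {F : M → Sym 𝕜 n} {k : Fin n} {x : M}

theorem ConditionN.exists_isCompl (hN : ConditionN (d := d) F k ν x) :
    ∃ U : Matrix (Fin n) (Fin ν) 𝕜, IsIsometryOnto U (eigspace k (F x)) ∧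
      IsCompl (LinearMap.range (compressedDeriv (d := d) F x U)) (Submodule.span ℝ {1}) := by
  obtain ⟨U, hU, B, hB, hperp⟩ := hN
  exact ⟨U, hU, isCompl_span_one_of_frobeniusPerp_eq_span hU.pos hB hperp⟩

end Criticality

section Stratum

variable {𝕜 : Type*} [RCLike 𝕜] {n ν d : ℕ} {r : ℕ∞ω} {M : Type*} [TopologicalSpace M]
  [ChartedSpace (EuclideanSpace ℝ (Fin d)) M] {F : M → Sym 𝕜 n} {k : Fin n} {x : M}
  {U : Matrix (Fin n) (Fin ν) 𝕜}

theorem surjective_mkQ_comp_of_codisjoint {R V W : Type*} [Ring R] [AddCommGroup V] [Module R V]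
    [AddCommGroup W] [Module R W] {f : V →ₗ[R] W} {p : Submodule R W}
    (hf : Codisjoint (LinearMap.range f) p) : Function.Surjective (p.mkQ ∘ₗ f) := by
  rw [← LinearMap.range_eq_top, LinearMap.range_comp, Submodule.map_mkQ_eq_top]
  exact hf.symm.eq_top

theorem eq_zero_of_smul_mem_of_disjoint_span_singleton {R W : Type*} [DivisionRing R]
    [AddCommGroup W] [Module R W] {p : Submodule R W} {w : W} (hw : w ≠ 0)
    (hp : Disjoint p (Submodule.span R {w})) {c : R} (hc : c • w ∈ p) : c = 0 := by
  by_contra hc0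
  exact (Submodule.disjoint_span_singleton' hw).1 hp ((p.smul_mem_iff hc0).1 hc)

theorem IsIsometryOnto.exists_stratum_equation_comp (hr : r ≠ 0)
    (hF : ContMDiff (𝓡 d) 𝓘(ℝ, Sym 𝕜 n) r F) (hU : IsIsometryOnto U (eigspace k (F x))) :
    ∃ (O : Set M) (μ : M → ℝ) (Φ : M → SymModScalars 𝕜 ν), IsOpen O ∧ x ∈ O ∧
      ContMDiffOn (𝓡 d) 𝓘(ℝ, ℝ) r μ O ∧
      ContMDiffOn (𝓡 d) 𝓘(ℝ, SymModScalars 𝕜 ν) r Φ O ∧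
      (∀ v (c : ℝ), compressedDeriv F x U v = c • 1 → mfderiv (𝓡 d) 𝓘(ℝ, ℝ) μ x v = c) ∧
      (∀ v, mfderiv (𝓡 d) 𝓘(ℝ, SymModScalars 𝕜 ν) Φ x v =
        modScalars (compressedDeriv F x U v)) ∧
      ∀ y ∈ O, (eigmult k (F y) = ν ↔ Φ y = 0) ∧
        (eigmult k (F y) = ν → eigval k (F y) = μ y) := by
  obtain ⟨μ, Φ, hμ, hΦ, hdμ, hdΦ, hloc⟩ := hU.exists_stratum_equation
  obtain ⟨O, hO, hO_open, hxO⟩ := eventually_nhds_iff.1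
    (((hμ.eventually (by simp)).and (hΦ.eventually (by simp))).and hloc)
  have hFx : MDifferentiableAt (𝓡 d) 𝓘(ℝ, Sym 𝕜 n) F x := hF.mdifferentiableAt hr
  have hμx : MDifferentiableAt 𝓘(ℝ, Sym 𝕜 n) 𝓘(ℝ, ℝ) μ (F x) :=
    (hμ.differentiableAt (by simp)).mdifferentiableAt
  have hΦx : MDifferentiableAt 𝓘(ℝ, Sym 𝕜 n) 𝓘(ℝ, SymModScalars 𝕜 ν) Φ (F x) :=
    (hΦ.differentiableAt (by simp)).mdifferentiableAt
  refine ⟨F ⁻¹' O, μ ∘ F, Φ ∘ F, hO_open.preimage hF.continuous, hxO,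
    fun y hy => ?_, fun y hy => ?_, fun v c hv => ?_, fun v => ?_, fun y hy => (hO _ hy).2⟩
  · exact (((hO _ hy).1.1.of_le le_top).contMDiffAt.comp y hF.contMDiffAt).contMDiffWithinAt
  · exact (((hO _ hy).1.2.of_le le_top).contMDiffAt.comp y hF.contMDiffAt).contMDiffWithinAt
  · rw [mfderiv_comp_apply x hμx hFx, mfderiv_eq_fderiv]
    exact hdμ _ c hv
  · rw [mfderiv_comp_apply x hΦx hFx, mfderiv_eq_fderiv]
    exact hdΦ _

theorem compressedDeriv_mfderiv_eq_smul_one {E H N : Type*} [NormedAddCommGroup E]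
    [NormedSpace ℝ E] [TopologicalSpace H] {I : ModelWithCorners ℝ E H} [TopologicalSpace N]
    [ChartedSpace H N] {μ : M → ℝ} {Φ : M → SymModScalars 𝕜 ν} {ι : N → M} {p : N}
    (hμ : MDifferentiableAt (𝓡 d) 𝓘(ℝ, ℝ) μ (ι p))
    (hΦ : MDifferentiableAt (𝓡 d) 𝓘(ℝ, SymModScalars 𝕜 ν) Φ (ι p))
    (hι : MDifferentiableAt I (𝓡 d) ι p)
    (hdμ : ∀ v (c : ℝ), compressedDeriv F (ι p) U v = c • 1 →
      mfderiv (𝓡 d) 𝓘(ℝ, ℝ) μ (ι p) v = c)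
    (hdΦ : ∀ v, mfderiv (𝓡 d) 𝓘(ℝ, SymModScalars 𝕜 ν) Φ (ι p) v =
      modScalars (compressedDeriv F (ι p) U v))
    (hΦι : ∀ q, Φ (ι q) = 0) {v : TangentSpace I p} {c : ℝ}
    (hc : mfderiv I 𝓘(ℝ, ℝ) (μ ∘ ι) p v = c) :
    compressedDeriv F (ι p) U (mfderiv I (𝓡 d) ι p v) = c • 1 := by
  have hker : mfderiv I 𝓘(ℝ, SymModScalars 𝕜 ν) (Φ ∘ ι) p v = 0 := by
    rw [funext hΦι (f := Φ ∘ ι) (g := fun _ => 0), mfderiv_const]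
    rfl
  rw [mfderiv_comp_apply p hΦ hι, hdΦ] at hker
  obtain ⟨b, hb⟩ := modScalars_eq_zero_iff.1 hker
  rw [mfderiv_comp_apply p hμ hι, hdμ _ b hb.symm] at hc
  rw [← hb, hc]

end Stratum

end EigStratum

end

theorem mainTheorem5_general {𝕜 : Type*} [RCLike 𝕜] {n d : ℕ} {M : Type*} [TopologicalSpace M]
    [ChartedSpace (EuclideanSpace ℝ (Fin d)) M] {r : ℕ∞ω} (hr : r ≠ 0) [IsManifold (𝓡 d) r M]
    {F : M → EigStratum.Sym 𝕜 n} (hF : ContMDiff (𝓡 d) 𝓘(ℝ, EigStratum.Sym 𝕜 n) r F)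
    {k : Fin n} {ν : ℕ} {x : M} {U : Matrix (Fin n) (Fin ν) 𝕜}
    (hU : EigStratum.IsIsometryOnto U (EigStratum.eigspace k (F x)))
    (hT : Codisjoint (LinearMap.range (EigStratum.compressedDeriv (d := d) F x U))
      (Submodule.span ℝ {1})) :
    ∃ (S : Set M) (m : ℕ) (_ : ChartedSpace (EuclideanSpace ℝ (Fin m)) S),
      IsManifold (𝓡 m) r S ∧
      Manifold.IsSmoothEmbedding (𝓡 m) (𝓡 d) r (Subtype.val : S → M) ∧
      (∀ᶠ y in 𝓝 x, EigStratum.eigmult k (F y) = ν ↔ y ∈ S) ∧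
      m + EigStratum.stratumCodim 𝕜 ν = d ∧
      ContMDiff (𝓡 m) 𝓘(ℝ, ℝ) r (fun y : S => EigStratum.eigval k (F y)) ∧
      ∃ hx : x ∈ S, ∀ (v : TangentSpace (𝓡 m) (⟨x, hx⟩ : S)) (c : ℝ),
        mfderiv (𝓡 m) 𝓘(ℝ, ℝ) (fun y : S => EigStratum.eigval k (F y)) ⟨x, hx⟩ v = c →
        EigStratum.compressedDeriv F x U
          (mfderiv (𝓡 m) (𝓡 d) (Subtype.val : S → M) ⟨x, hx⟩ v) = c • 1 := by
  obtain ⟨O, μ, Φ, hO, hxO, hμ, hΦ, hdμ, hdΦ, hloc⟩ := hU.exists_stratum_equation_comp hr hF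
  have hsurj := EigStratum.surjective_mkQ_comp_of_codisjoint hT
  have hΦx : Φ x = 0 := (hloc x hxO).1.1 hU.finrank_eq
  obtain ⟨W, m, hW, hxW, hWO, hm, cs, hS, hι⟩ :=
    EigStratum.exists_isSmoothEmbedding_zeroSet hr hO hΦ hxO hΦx fun q =>
      (hsurj q).imp fun v hv => (hdΦ v).trans hv
  have heig : (fun y : {y | y ∈ W ∧ Φ y = 0} => EigStratum.eigval k (F y)) = μ ∘ Subtype.val :=
    funext fun y => (hloc y (hWO y.2.1)).2 ((hloc y (hWO y.2.1)).1.2 y.2.2)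
  rw [EigStratum.finrank_symModScalars hU.pos, finrank_euclideanSpace_fin] at hm
  refine ⟨{y | y ∈ W ∧ Φ y = 0}, m, cs, hS, hι, ?_, hm, ?_, ⟨hxW, hΦx⟩, fun v c hc => ?_⟩
  · filter_upwards [hW.mem_nhds hxW] with y hy
    exact (hloc y (hWO hy)).1.trans (and_iff_right hy).symm
  · exact heig ▸ hμ.comp_contMDiff hι.contMDiff fun y => hWO y.2.1
  · rw [heig] at hc
    have hμ_diff := (hμ.contMDiffAt (hO.mem_nhds hxO)).mdifferentiableAt hr
    have hΦ_diff := (hΦ.contMDiffAt (hO.mem_nhds hxO)).mdifferentiableAt hr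
    have hι_diff := hι.contMDiff.mdifferentiableAt hr (x := ⟨x, hxW, hΦx⟩)
    exact EigStratum.compressedDeriv_mfderiv_eq_smul_one hμ_diff hΦ_diff hι_diff hdμ hdΦ
      (fun q => q.2.2) hc

theorem mainTheorem5 {𝕜 : Type*} [RCLike 𝕜] {n d : ℕ} {M : Type*} [TopologicalSpace M]
    [ChartedSpace (EuclideanSpace ℝ (Fin d)) M] [IsManifold (𝓡 d) ∞ M]
    (F : M → EigStratum.Sym 𝕜 n) (hF : ContMDiff (𝓡 d) 𝓘(ℝ, EigStratum.Sym 𝕜 n) ∞ F)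
    (k : Fin n) (ν : ℕ) (x : M) (hν : EigStratum.eigmult k (F x) = ν)
    (hN : EigStratum.ConditionN (d := d) F k ν x) :
    ∃ (S : Set M) (m : ℕ) (_ : ChartedSpace (EuclideanSpace ℝ (Fin m)) S),
      IsManifold (𝓡 m) ∞ S ∧
      Manifold.IsSmoothEmbedding (𝓡 m) (𝓡 d) ∞ (Subtype.val : S → M) ∧
      (∀ᶠ y in 𝓝 x, EigStratum.eigmult k (F y) = ν ↔ y ∈ S) ∧
      m + EigStratum.stratumCodim 𝕜 ν = d ∧
      ContMDiff (𝓡 m) 𝓘(ℝ, ℝ) ∞ (fun y : S => EigStratum.eigval k (F y)) ∧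
      ∃ hx : x ∈ S,
        mfderiv (𝓡 m) 𝓘(ℝ, ℝ) (fun y : S => EigStratum.eigval k (F y)) ⟨x, hx⟩ = 0 := by
  obtain ⟨U, hU, hH⟩ := hN.exists_isCompl
  obtain ⟨S, m, cs, hS, hι, hmult, hm, heig, hx, hderiv⟩ :=
    mainTheorem5_general (by simp) hF hU hH.codisjoint
  refine ⟨S, m, cs, hS, hι, hmult, hm, heig, hx, ContinuousLinearMap.ext fun v => ?_⟩
  exact EigStratum.eq_zero_of_smul_mem_of_disjoint_span_singleton
    (EigStratum.Sym.one_ne_zero hU.pos) hH.disjoint ⟨_, hderiv v _ rfl⟩
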